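/- Let $W:\mathbb R\to\mathbb C^{N\times N}$ be a weight matrix, Hermitian positive definite at every $x\in\mathbb R$, with finite moments, i.e. $x^kW_{ij}(x)$ is integrable on $\mathbb R$ for all $k\ge 0$ and all $i,j$. Assume that $W(x)=T(x)T(x)^*$ for $x\in\mathbb R$, where $T$ is differentiable and $T'(x)=G(x)T(x)$ on $\mathbb R$ for a matrix polynomial $G(z)=\sum_{j=0}^m M_jz^j$ of degree $m$, $M_j\in\mathbb C^{N\times N}$. For a matrix function $F$ of a complex variable write $F^*(z)=(F(\bar z))^*$, and let $(P,Q)_W=\int_{\mathbb R}P(x)W(x)Q(x)^*\,dx$, integrated entrywise. Let $\widehat P_n(x)=x^nI+\sum_{j<n}a_{n,j}x^j$ be the matrix polynomials obtained from $I,xI,x^2I,\dots$ by the (monic) Gram–Schmidt procedure with respect to $(\cdot,\cdot)_W$. Put $a_{n,n}=I$, $a_{n,j}=0$ for $j<0$, and $$b_{n,k}=\int_{\mathbb R}x^k\widehat P_n(x)W(x)\,dx,\qquad \gamma_n=(\widehat P_n,\widehat P_n)_W^{-1}$$ (so $\gamma_n=\kappa_n^*\kappa_n$ whenever $\kappa_n\widehat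 P_n$ is orthonormal), $\alpha_n=a_{n,n-1}-a_{n+1,n}$, $\beta_n=\gamma_n^{-1}\gamma_{n-1}$ for $n\ge1$, $\beta_0=0$. Let $$\widehat P_{n,k}(z)=\sum_{i=0}^{k}a_{n,n-i}z^{k-i},\qquad \Delta_{j,n}(z)=\sum_{k=0}^{j}\widehat P_{n,k}(z)M_{m-j+k},$$ $$\mathcal A_n(z;G)=-\gamma_n\sum_{j=0}^{m-1}\Big(b_{n,n+m-j-1}\Delta_{j,n}^*(z)+\Delta_{j,n}(z)b_{n,n+m-j-1}^*\Big),\qquad n\ge0,$$ $$\mathcal B_n(z;G)=-\Big(\sum_{j=0}^{m}\Delta_{j,n}(z)b_{n-1,n+m-j-1}^*+\sum_{j=0}^{m-1}b_{n,n+m-j-2}\Delta_{j,n-1}^*(z)\Big)\gamma_{n-1},\quad n\ge1,\qquad \mathcal B_0(z;G)=-G(z).$$ Then $(\widehat P_n)_n$ is the sequence of monic orthogonal matrix polynomials of $W$ (that is, $(\widehat P_n,Q)_W=0$ for every matrix polynomial $Q$ of degree less than $n$), it satisfies the three-term recurrence relation $$x\widehat P_n(x)=\widehat P_{n+1}(x)+\alpha_n\widehat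 P_n(x)+\beta_n\widehat P_{n-1}(x),\qquad n\ge0$$ (without the last term for $n=0$), and for every $n\ge0$ and every $z\in\mathbb C$ the compatibility conditions $$I+\mathcal B_{n+1}(z;G)(zI-\alpha_n)-(zI-\alpha_n)\mathcal B_n(z;G)=\mathcal A_{n+1}^*(z;G)\beta_{n+1}-\beta_n\mathcal A_{n-1}^*(z;G)$$ (without the last term for $n=0$) and $$\mathcal B_{n+1}(z;G)+\gamma_n^{-1}\mathcal B_n^*(z;G)\gamma_n=(zI-\alpha_n)\mathcal A_n^*(z;G)$$ hold. -/

import Mathlib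

open Polynomial
open scoped ComplexOrder

/-- Complex `N × N` matrices. -/
abbrev Mat (N : ℕ) := Matrix (Fin N) (Fin N) ℂ

/-- The entrywise integral over the real line of a matrix-valued function. -/
noncomputable def matIntegral {N : ℕ} (F : ℝ → Mat N) : Mat N :=
  Matrix.of fun i j => ∫ x : ℝ, F x i j

/-- The value `∑ₖ zᵏ Aₖ` at the scalar `z` of the matrix polynomial with coefficients `Aₖ`. -/
noncomputable def evalAt {N : ℕ} (P : (Mat N)[X]) (z : ℂ) : Mat N :=
  P.eval (Matrix.scalar (Fin N) z)

/-- `F*(z) = (F(z̄))*`, for a matrix-valued function of a complex variable. -/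
noncomputable def conjStar {N : ℕ} (F : ℂ → Mat N) (z : ℂ) : Mat N :=
  (F (starRingEnd ℂ z)).conjTranspose

/-- `(P, Q)_W = ∫ P(x) W(x) Q(x)* dx` over the real line. -/
noncomputable def mip {N : ℕ} (W : ℝ → Mat N) (P Q : (Mat N)[X]) : Mat N :=
  matIntegral fun x => evalAt P (x : ℂ) * W x * (evalAt Q (x : ℂ)).conjTranspose

/-- `P` is the sequence of monic matrix polynomials (of degree `n` for each `n`) orthogonal
with respect to `W`: `Pₙ` has leading coefficient `I` and `(Pₙ, Q)_W = 0` whenever `deg Q < n`. -/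
def IsMonicMOPRL {N : ℕ} (W : ℝ → Mat N) (P : ℕ → (Mat N)[X]) : Prop :=
  ∀ n : ℕ, (P n).coeff n = 1 ∧ (∀ k : ℕ, n < k → (P n).coeff k = 0) ∧
    ∀ Q : (Mat N)[X], (∀ k : ℕ, n ≤ k → Q.coeff k = 0) → mip W (P n) Q = 0

/-- The monic orthogonal matrix polynomials of `W`, built by the Gram--Schmidt procedure. -/
noncomputable def monicOP {N : ℕ} (W : ℝ → Mat N) (n : ℕ) : (Mat N)[X] :=
  X ^ n - ∑ k : Fin n, C (mip W (X ^ n) (monicOP W k) *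
    (mip W (monicOP W k) (monicOP W k))⁻¹) * monicOP W k
termination_by n
decreasing_by all_goals exact k.isLt

/-- `aCoeff W n i` is `a_{n,n-i}`, the coefficient of `x^{n-i}` in the `n`-th monic orthogonal
polynomial (so `a_{n,n} = I`), with `a_{n,n-i} = 0` for `i > n`. -/
noncomputable def aCoeff {N : ℕ} (W : ℝ → Mat N) (n i : ℕ) : Mat N :=
  if i ≤ n then (monicOP W n).coeff (n - i) else 0

/-- `b_{n,k} = ∫ xᵏ Pₙ(x) W(x) dx`, with `Pₙ` the monic orthogonal polynomials. -/
noncomputable def bCoeff {N : ℕ} (W : ℝ → Mat N) (n k : ℕ) : Mat N :=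
  matIntegral fun x => ((x : ℂ) ^ k) • (evalAt (monicOP W n) (x : ℂ) * W x)

/-- `γₙ`, the matrix `κₙ* κₙ` for any `κₙ` that makes `κₙ Pₙ` orthonormal
(see `conjTranspose_mul_self_eq_gammaCoeff`). -/
noncomputable def gammaCoeff {N : ℕ} (W : ℝ → Mat N) (n : ℕ) : Mat N :=
  (mip W (monicOP W n) (monicOP W n))⁻¹

/-- If `κ Pₙ` is normalized, i.e. `κ (Pₙ, Pₙ)_W κ* = I`, then `κ* κ = γₙ`. -/
theorem conjTranspose_mul_self_eq_gammaCoeff {N : ℕ} (W : ℝ → Mat N) (n : ℕ) (κ : Mat N)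
    (h : κ * mip W (monicOP W n) (monicOP W n) * κ.conjTranspose = 1) :
    κ.conjTranspose * κ = gammaCoeff W n := by
  have h1 : mip W (monicOP W n) (monicOP W n) * κ.conjTranspose * κ = 1 := by
    rw [Matrix.mul_assoc] at h
    exact mul_eq_one_comm.mp h
  rw [Matrix.mul_assoc] at h1
  exact (Matrix.inv_eq_right_inv h1).symm

/-- `αₙ = a_{n,n-1} - a_{n+1,n}`. -/
noncomputable def alphaCoeff {N : ℕ} (W : ℝ → Mat N) (n : ℕ) : Mat N :=
  aCoeff W n 1 - aCoeff W (n + 1) 1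

/-- `βₙ = γₙ⁻¹ γₙ₋₁` for `n ≥ 1`, and `β₀ = 0`. -/
noncomputable def betaCoeff {N : ℕ} (W : ℝ → Mat N) : ℕ → Mat N
  | 0 => 0
  | n + 1 => (gammaCoeff W (n + 1))⁻¹ * gammaCoeff W n

/-- `P_{n,k}(z) = zᵏ I + a_{n,n-1} zᵏ⁻¹ + ⋯ + a_{n,n-k}`. -/
noncomputable def partialOP {N : ℕ} (W : ℝ → Mat N) (n k : ℕ) (z : ℂ) : Mat N :=
  ∑ i ∈ Finset.range (k + 1), z ^ (k - i) • aCoeff W n i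

/-- `Δ_{j,n}(z) = ∑_{k=0}^{j} P_{n,k}(z) M_{m-j+k}`, where `G(z) = ∑_{j=0}^{m} M_j zʲ`. -/
noncomputable def deltaOP {N : ℕ} (W : ℝ → Mat N) (G : (Mat N)[X]) (j n : ℕ) (z : ℂ) : Mat N :=
  ∑ k ∈ Finset.range (j + 1), partialOP W n k z * G.coeff (G.natDegree - j + k)

/-- `𝒜ₙ(z; G) = -γₙ ∑_{j=0}^{m-1} (b_{n,n+m-j-1} Δ_{j,n}*(z) + Δ_{j,n}(z) b_{n,n+m-j-1}*)`. -/
noncomputable def coeffA {N : ℕ} (W : ℝ → Mat N) (G : (Mat N)[X]) (n : ℕ) (z : ℂ) : Mat N :=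
  -(gammaCoeff W n * ∑ j ∈ Finset.range G.natDegree,
    (bCoeff W n (n + G.natDegree - j - 1) * conjStar (deltaOP W G j n) z +
      deltaOP W G j n z * (bCoeff W n (n + G.natDegree - j - 1)).conjTranspose))

/-- `ℬₙ(z; G) = -(∑_{j=0}^{m} Δ_{j,n}(z) b_{n-1,n+m-j-1}* + b_{n,n+m-j-2} Δ_{j,n-1}*(z)) γₙ₋₁`
for `n ≥ 1`; in the second summand the term `j = m` is left out, as there the coefficient
`b_{n,n-2}` is zero.
For `n = 0` the function `Y⁰` has block rows `(I, 𝒞(W))` and `(0, I)`, so that the block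
`(1,1)` of `(X⁰)' (X⁰)⁻¹`, which is `-ℬ₀`, equals `T' T⁻¹ = G`. This is the formula
for `n ≥ 1` with `P₋₁ = 0` and `b_{-1,k}* γ₋₁ = I` if `k = -1`, `0` if `k ≥ 0`. -/
noncomputable def coeffB {N : ℕ} (W : ℝ → Mat N) (G : (Mat N)[X]) : ℕ → ℂ → Mat N
  | 0, z => -evalAt G z
  | n + 1, z =>
    -((∑ j ∈ Finset.range (G.natDegree + 1),
          deltaOP W G j (n + 1) z * (bCoeff W n (n + 1 + G.natDegree - j - 1)).conjTranspose) +
        ∑ j ∈ Finset.range G.natDegree,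
          bCoeff W (n + 1) (n + 1 + G.natDegree - j - 2) * conjStar (deltaOP W G j n) z) *
      gammaCoeff W n

/-! Write `P n` for the monic orthogonal polynomials and `D_z F = (F(x) - F(z)) / (x - z)`.
Everything is governed by one sesquilinear form, `S(P, Q) = (D_z(PG), Q) + (P, D_{z̄}(QG))`. Reading
off coefficients of `D_z(P n * G)` and discarding those killed by orthogonality turns the explicit
sums into `𝒜ₙ = -γₙ S(P n, P n)` and `ℬₙ₊₁ = -S(P (n+1), P n) γₙ` (`coeffA_eq`, `coeffB_succ`).

Since `W' = GW + WG*`, integrating `(P W Q*)'` over the line gives `(P', Q) + (P, Q') + (PG, Q) +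
(P, QG) = 0` (`mip_derivative_add`). Multiplying an argument of `S` by `x` produces precisely the
last two terms, so `S(xP, Q) = z S(P, Q) - (P', Q) - (P, Q')` up to a boundary term containing `(P,
1)` (`compatForm_X_mul_left`, and its adjoint `compatForm_X_mul_right`).

The recurrence is now inserted for `xP`. On the diagonal pair the derivative terms vanish, which is
the second condition. For the first, `S(x P (n+1), P n)` and `S(P (n+2), x P (n+1))` both contain
`S(P (n+2), P n)`; eliminating it leaves the derivative contributions `n + 2` and `n + 1`, whose
difference is the `I`. At index zero `(P 0, 1)` is nonzero, and the boundary term supplies `ℬ₀ =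
-G`. -/

/-! ### Evaluation of matrix polynomials at scalars, and entrywise derivatives. -/

section Evaluation

variable {N : ℕ}

/-- Evaluation of matrix polynomials at a scalar, as a ring homomorphism. -/
noncomputable def evalAtRingHom (N : ℕ) (z : ℂ) : (Mat N)[X] →+* Mat N :=
  eval₂RingHom' (RingHom.id _) (Matrix.scalar (Fin N) z) fun a =>
    (Matrix.scalar_commute z (fun _ => Commute.all _ _) a).symm

theorem evalAt_add (P Q : (Mat N)[X]) (z : ℂ) : evalAt (P + Q) z = evalAt P z + evalAt Q z :=
  map_add (evalAtRingHom N z) P Q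

theorem evalAt_sub (P Q : (Mat N)[X]) (z : ℂ) : evalAt (P - Q) z = evalAt P z - evalAt Q z :=
  map_sub (evalAtRingHom N z) P Q

theorem evalAt_mul (P Q : (Mat N)[X]) (z : ℂ) : evalAt (P * Q) z = evalAt P z * evalAt Q z :=
  map_mul (evalAtRingHom N z) P Q

theorem evalAt_C (A : Mat N) (z : ℂ) : evalAt (C A) z = A := eval_C

theorem evalAt_X (z : ℂ) : evalAt (X : (Mat N)[X]) z = Matrix.scalar (Fin N) z := eval_X

theorem evalAt_monomial (k : ℕ) (A : Mat N) (z : ℂ) :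
    evalAt (monomial k A) z = z ^ k • A := by
  rw [evalAt, eval_monomial, ← map_pow, Matrix.scalar_apply, ← Matrix.smul_one_eq_diagonal,
    mul_smul_comm, mul_one]

theorem evalAt_X_pow (k : ℕ) (z : ℂ) : evalAt (X ^ k : (Mat N)[X]) z = z ^ k • 1 := by
  rw [← monomial_one_right_eq_X_pow, evalAt_monomial]

theorem scalar_mul_eq_smul (z : ℂ) (A : Mat N) : Matrix.scalar (Fin N) z * A = z • A := by
  rw [Matrix.scalar_apply, ← Matrix.smul_one_eq_diagonal, smul_mul_assoc, one_mul]

theorem conjTranspose_scalar (z : ℂ) :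
    (Matrix.scalar (Fin N) z).conjTranspose = Matrix.scalar (Fin N) (starRingEnd ℂ z) := by
  simp [Matrix.diagonal_conjTranspose, Pi.star_def]

/-- Reduces integrability and vanishing questions to scalar polynomials. -/
theorem exists_entry_polynomial (P : (Mat N)[X]) (i j : Fin N) :
    ∃ p : ℂ[X], (∀ z, evalAt P z i j = p.eval z) ∧ ∀ k, P.coeff k i j = p.coeff k := by
  refine ⟨matPolyEquiv.symm P i j, fun z => ?_, fun k => ?_⟩
  · rw [← matPolyEquiv_eval, AlgEquiv.apply_symm_apply, evalAt]
  · rw [matPolyEquiv_symm_apply_coeff]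

theorem hasDerivAt_evalAt (P : (Mat N)[X]) (x : ℝ) (i j : Fin N) :
    HasDerivAt (fun t : ℝ => evalAt P (t : ℂ) i j) (evalAt (derivative P) (x : ℂ) i j) x := by
  induction P using Polynomial.induction_on' with
  | add p q hp hq =>
    simp only [evalAt_add, derivative_add, Matrix.add_apply]
    exact hp.add hq
  | monomial k A =>
    simp only [derivative_monomial, evalAt_monomial, Matrix.smul_apply, smul_eq_mul]
    refine (((hasDerivAt_pow k (x : ℂ)).comp_ofReal).mul_const (A i j)).congr_deriv ?_
    rw [← nsmul_eq_mul', Matrix.smul_apply, nsmul_eq_mul]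
    ring

theorem HasDerivAt.matrix_mul_apply {A B : ℝ → Mat N} {A' B' : Mat N} {x : ℝ}
    (hA : ∀ i j, HasDerivAt (fun t => A t i j) (A' i j) x)
    (hB : ∀ i j, HasDerivAt (fun t => B t i j) (B' i j) x) (i j : Fin N) :
    HasDerivAt (fun t => (A t * B t) i j) ((A' * B x + A x * B') i j) x := by
  simp only [Matrix.mul_apply, Matrix.add_apply, ← Finset.sum_add_distrib]
  exact HasDerivAt.fun_sum fun k _ => (hA i k).mul (hB k j)

theorem HasDerivAt.matrix_conjTranspose_apply {A : ℝ → Mat N} {A' : Mat N} {x : ℝ}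
    (hA : ∀ i j, HasDerivAt (fun t => A t i j) (A' i j) x) (i j : Fin N) :
    HasDerivAt (fun t => (A t).conjTranspose i j) (A'.conjTranspose i j) x := by
  simpa only [Matrix.conjTranspose_apply] using (hA j i).star

end Evaluation

/-! ### Divided differences. -/

section DividedDifference

variable {N : ℕ}

/-- The divided difference `(F(x) - F(z)) / (x - z)`, as a matrix polynomial in `x`. -/
noncomputable def dividedDiff (z : ℂ) (F : (Mat N)[X]) : (Mat N)[X] :=
  F /ₘ (X - C (Matrix.scalar (Fin N) z))

theorem C_scalar_mul_comm (z : ℂ) (F : (Mat N)[X]) :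
    C (Matrix.scalar (Fin N) z) * F = F * C (Matrix.scalar (Fin N) z) := by
  ext1 k
  rw [coeff_C_mul, coeff_mul_C]
  exact Matrix.scalar_commute z (fun _ => Commute.all _ _) _

/-- The scalar matrix is central, so evaluation at it is multiplicative and the constant remainder
of the division must be the value of `F`. -/
theorem X_sub_C_mul_dividedDiff (z : ℂ) (F : (Mat N)[X]) :
    (X - C (Matrix.scalar (Fin N) z)) * dividedDiff z F = F - C (evalAt F z) := by
  -- `N = 0` is allowed, and the degree bound on the remainder needs a nontrivial ring.
  nontriviality (Mat N)
  have hm := monic_X_sub_C (Matrix.scalar (Fin N) z)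
  have h := modByMonic_add_div F (X - C (Matrix.scalar (Fin N) z))
  have hdeg : (F %ₘ (X - C (Matrix.scalar (Fin N) z))).degree < 1 := by
    simpa using degree_modByMonic_lt F hm
  rw [eq_C_of_degree_le_zero (Nat.WithBot.lt_one_iff_le_zero.mp hdeg)] at h
  have he := congrArg (fun Q => evalAt Q z) h
  simp only [evalAt_add, evalAt_mul, evalAt_sub, evalAt_X, evalAt_C, sub_self, zero_mul,
    add_zero] at he
  rw [he] at h
  exact eq_sub_of_add_eq' h

theorem eq_dividedDiff {z : ℂ} {F Q : (Mat N)[X]}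
    (h : (X - C (Matrix.scalar (Fin N) z)) * Q = F - C (evalAt F z)) : Q = dividedDiff z F :=
  (monic_X_sub_C (Matrix.scalar (Fin N) z)).isRegular.left
    (h.trans (X_sub_C_mul_dividedDiff z F).symm)

theorem dividedDiff_add (z : ℂ) (F H : (Mat N)[X]) :
    dividedDiff z (F + H) = dividedDiff z F + dividedDiff z H := by
  refine (eq_dividedDiff ?_).symm
  rw [mul_add, X_sub_C_mul_dividedDiff, X_sub_C_mul_dividedDiff, evalAt_add, C_add]
  abel

theorem dividedDiff_C_mul (z : ℂ) (A : Mat N) (F : (Mat N)[X]) :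
    dividedDiff z (C A * F) = C A * dividedDiff z F := by
  refine (eq_dividedDiff ?_).symm
  rw [← mul_assoc, sub_mul, X_mul, C_scalar_mul_comm, ← mul_sub, mul_assoc,
    X_sub_C_mul_dividedDiff, evalAt_mul, evalAt_C, mul_sub, C_mul]

theorem dividedDiff_X_mul (z : ℂ) (F : (Mat N)[X]) :
    dividedDiff z (X * F) = C (Matrix.scalar (Fin N) z) * dividedDiff z F + F := by
  refine (eq_dividedDiff ?_).symm
  rw [mul_add, C_scalar_mul_comm, ← mul_assoc, X_sub_C_mul_dividedDiff, evalAt_mul, evalAt_X,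
    C_mul, ← C_scalar_mul_comm]
  simp only [mul_sub, sub_mul]
  abel

/-- Differs from `dividedDiff_X_mul` only by the value at `z`; this discrepancy is the source of the
boundary terms below. -/
theorem X_mul_dividedDiff (z : ℂ) (F : (Mat N)[X]) :
    X * dividedDiff z F =
      C (Matrix.scalar (Fin N) z) * dividedDiff z F + F - C (evalAt F z) := by
  rw [add_sub_assoc, ← X_sub_C_mul_dividedDiff, sub_mul]
  abel

end DividedDifference

/-! ### The matrix inner product: integrability, integration by parts, definiteness. -/

section Form

variable {N : ℕ}

/-- A positive definite matrix weight on the real line with finite moments. -/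
structure IsMatrixWeight (W : ℝ → Mat N) : Prop where
  posDef : ∀ x : ℝ, (W x).PosDef
  integrable : ∀ (k : ℕ) (i j : Fin N),
    MeasureTheory.Integrable (fun x : ℝ => (x : ℂ) ^ k * W x i j) MeasureTheory.volume

variable {W : ℝ → Mat N}

theorem IsMatrixWeight.integrable_eval_mul (hW : IsMatrixWeight W) (p : ℂ[X]) (i j : Fin N) :
    MeasureTheory.Integrable (fun x : ℝ => p.eval (x : ℂ) * W x i j) := by
  induction p using Polynomial.induction_on' with
  | add p q hp hq =>
    simp only [eval_add, add_mul]
    exact hp.add hq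
  | monomial k a =>
    simp only [eval_monomial, mul_assoc]
    exact (hW.integrable k i j).const_mul a

theorem star_eval_ofReal (p : ℂ[X]) (x : ℝ) :
    star (p.eval (x : ℂ)) = (p.map (starRingEnd ℂ)).eval (x : ℂ) := by
  have h := Polynomial.hom_eval₂ p (RingHom.id ℂ) (starRingEnd ℂ) (x : ℂ)
  rw [RingHom.comp_id, Complex.conj_ofReal] at h
  rw [eval_map]
  exact h

theorem IsMatrixWeight.integrable_mip (hW : IsMatrixWeight W) (P Q : (Mat N)[X]) (i j : Fin N) :
    MeasureTheory.Integrable (fun x : ℝ =>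
      (evalAt P (x : ℂ) * W x * (evalAt Q (x : ℂ)).conjTranspose) i j) := by
  simp only [Matrix.mul_apply, Matrix.conjTranspose_apply, Finset.sum_mul]
  refine MeasureTheory.integrable_finsetSum _ fun l _ =>
    MeasureTheory.integrable_finsetSum _ fun k _ => ?_
  obtain ⟨p, hp, -⟩ := exists_entry_polynomial P i k
  obtain ⟨q, hq, -⟩ := exists_entry_polynomial Q j l
  refine (hW.integrable_eval_mul (p * q.map (starRingEnd ℂ)) k l).congr
    (Filter.Eventually.of_forall fun x => ?_)
  simp only [hp, hq, eval_mul, star_eval_ofReal]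
  ring

theorem mip_apply (P Q : (Mat N)[X]) (i j : Fin N) :
    mip W P Q i j =
      ∫ x : ℝ, (evalAt P (x : ℂ) * W x * (evalAt Q (x : ℂ)).conjTranspose) i j := rfl

theorem conjTranspose_mip (hW : IsMatrixWeight W) (P Q : (Mat N)[X]) :
    (mip W P Q).conjTranspose = mip W Q P := by
  ext i j
  rw [Matrix.conjTranspose_apply, mip_apply, mip_apply, Complex.star_def, ← integral_conj]
  congr 1
  ext x
  rw [← Complex.star_def, ← Matrix.conjTranspose_apply, Matrix.conjTranspose_mul,
    Matrix.conjTranspose_mul, Matrix.conjTranspose_conjTranspose, (hW.posDef x).1.eq,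
    Matrix.mul_assoc]

theorem mip_add_left (hW : IsMatrixWeight W) (P₁ P₂ Q : (Mat N)[X]) :
    mip W (P₁ + P₂) Q = mip W P₁ Q + mip W P₂ Q := by
  ext i j
  rw [Matrix.add_apply, mip_apply, mip_apply, mip_apply,
    ← MeasureTheory.integral_add (hW.integrable_mip P₁ Q i j) (hW.integrable_mip P₂ Q i j)]
  simp only [evalAt_add, add_mul, Matrix.add_apply]

theorem mip_C_mul_left (hW : IsMatrixWeight W) (A : Mat N) (P Q : (Mat N)[X]) :
    mip W (C A * P) Q = A * mip W P Q := by
  ext i j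
  rw [Matrix.mul_apply, mip_apply]
  simp only [mip_apply, ← MeasureTheory.integral_const_mul]
  rw [← MeasureTheory.integral_finsetSum _ fun k _ =>
    (hW.integrable_mip P Q k j).const_mul (A i k)]
  simp only [evalAt_mul, evalAt_C, Matrix.mul_assoc, Matrix.mul_apply (M := A)]

theorem mip_X_mul_left (P Q : (Mat N)[X]) : mip W (X * P) Q = mip W P (X * Q) := by
  ext i j
  simp only [mip_apply, evalAt_mul, evalAt_X, Matrix.conjTranspose_mul, conjTranspose_scalar,
    Complex.conj_ofReal]
  congr 1
  ext x
  rw [← Matrix.mul_assoc, ← (Matrix.scalar_commute _ (fun _ => Commute.all _ _) _).eq]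
  simp only [Matrix.mul_assoc]

theorem mip_add_right (hW : IsMatrixWeight W) (P Q₁ Q₂ : (Mat N)[X]) :
    mip W P (Q₁ + Q₂) = mip W P Q₁ + mip W P Q₂ := by
  rw [← conjTranspose_mip hW, mip_add_left hW, Matrix.conjTranspose_add, conjTranspose_mip hW,
    conjTranspose_mip hW]

theorem mip_C_mul_right (hW : IsMatrixWeight W) (A : Mat N) (P Q : (Mat N)[X]) :
    mip W P (C A * Q) = mip W P Q * A.conjTranspose := by
  rw [← conjTranspose_mip hW, mip_C_mul_left hW, Matrix.conjTranspose_mul, conjTranspose_mip hW]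

/-- `P ↦ (P, Q)_W` as an additive map. -/
noncomputable def mipLeftHom (hW : IsMatrixWeight W) (Q : (Mat N)[X]) : (Mat N)[X] →+ Mat N :=
  AddMonoidHom.mk' (fun P => mip W P Q) fun P₁ P₂ => mip_add_left hW P₁ P₂ Q

theorem mip_sub_left (hW : IsMatrixWeight W) (P₁ P₂ Q : (Mat N)[X]) :
    mip W (P₁ - P₂) Q = mip W P₁ Q - mip W P₂ Q := map_sub (mipLeftHom hW Q) P₁ P₂

theorem mip_sum_left (hW : IsMatrixWeight W) {ι : Type*} (s : Finset ι) (P : ι → (Mat N)[X])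
    (Q : (Mat N)[X]) : mip W (∑ k ∈ s, P k) Q = ∑ k ∈ s, mip W (P k) Q :=
  map_sum (mipLeftHom hW Q) P s

theorem mip_zero_left (hW : IsMatrixWeight W) (Q : (Mat N)[X]) : mip W 0 Q = 0 :=
  map_zero (mipLeftHom hW Q)

theorem mip_zero_right (hW : IsMatrixWeight W) (Q : (Mat N)[X]) : mip W Q 0 = 0 := by
  rw [← conjTranspose_mip hW, mip_zero_left hW, Matrix.conjTranspose_zero]

theorem mip_sub_right (hW : IsMatrixWeight W) (P Q₁ Q₂ : (Mat N)[X]) :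
    mip W P (Q₁ - Q₂) = mip W P Q₁ - mip W P Q₂ := by
  rw [← conjTranspose_mip hW, mip_sub_left hW, Matrix.conjTranspose_sub, conjTranspose_mip hW,
    conjTranspose_mip hW]

/-- The four terms integrate the derivative of `P W Q*`, because `W = TT*` gives `W' = GW + WG*`.
That function and its derivative are both integrable by the moment condition, so the integral is
zero without any separate decay assumption. -/
theorem mip_derivative_add (hW : IsMatrixWeight W) {T : ℝ → Mat N} {G : (Mat N)[X]}
    (hWT : ∀ x : ℝ, W x = T x * (T x).conjTranspose)
    (hTG : ∀ (x : ℝ) (i j : Fin N),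
      HasDerivAt (fun t : ℝ => T t i j) ((evalAt G (x : ℂ) * T x) i j) x)
    (P Q : (Mat N)[X]) :
    mip W (derivative P) Q + mip W P (derivative Q) + mip W (P * G) Q + mip W P (Q * G) = 0 := by
  ext i j
  simp only [Matrix.add_apply, mip_apply, Matrix.zero_apply]
  have h₁ := hW.integrable_mip (derivative P) Q i j
  have h₂ := hW.integrable_mip P (derivative Q) i j
  have h₃ := hW.integrable_mip (P * G) Q i j
  have h₄ := hW.integrable_mip P (Q * G) i j
  refine Eq.trans ?_ (MeasureTheory.integral_eq_zero_of_hasDerivAt_of_integrable (fun x => ?_)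
    (((h₁.add h₂).add h₃).add h₄) (hW.integrable_mip P Q i j))
  · rw [MeasureTheory.integral_add' ((h₁.add h₂).add h₃) h₄,
      MeasureTheory.integral_add' (h₁.add h₂) h₃, MeasureTheory.integral_add' h₁ h₂]
  have hd : ∀ i j, HasDerivAt (fun t => W t i j)
      ((evalAt G (x : ℂ) * W x + W x * (evalAt G (x : ℂ)).conjTranspose) i j) x := by
    intro i j
    simp only [hWT]
    refine (HasDerivAt.matrix_mul_apply (hTG x)
      (HasDerivAt.matrix_conjTranspose_apply (hTG x)) i j).congr_deriv ?_
    rw [Matrix.conjTranspose_mul]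
    simp only [Matrix.mul_assoc]
  refine (HasDerivAt.matrix_mul_apply (HasDerivAt.matrix_mul_apply (hasDerivAt_evalAt P x) hd)
    (HasDerivAt.matrix_conjTranspose_apply (hasDerivAt_evalAt Q x)) i j).congr_deriv ?_
  simp only [evalAt_mul, Matrix.conjTranspose_mul, Matrix.add_mul, Matrix.mul_add, Matrix.mul_assoc,
    Matrix.add_apply, Pi.add_apply]
  ring

theorem dotProduct_mip_mulVec (hW : IsMatrixWeight W) (P : (Mat N)[X]) (v : Fin N → ℂ) :
    MeasureTheory.Integrable (fun x : ℝ =>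
      dotProduct (star ((evalAt P (x : ℂ)).conjTranspose.mulVec v))
        ((W x).mulVec ((evalAt P (x : ℂ)).conjTranspose.mulVec v))) ∧
    dotProduct (star v) ((mip W P P).mulVec v) = ∫ x : ℝ,
      dotProduct (star ((evalAt P (x : ℂ)).conjTranspose.mulVec v))
        ((W x).mulVec ((evalAt P (x : ℂ)).conjTranspose.mulVec v)) := by
  have he : ∀ x : ℝ, dotProduct (star ((evalAt P (x : ℂ)).conjTranspose.mulVec v))
        ((W x).mulVec ((evalAt P (x : ℂ)).conjTranspose.mulVec v)) =
      ∑ i, ∑ j, star (v i) *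
        ((evalAt P (x : ℂ) * W x * (evalAt P (x : ℂ)).conjTranspose) i j * v j) := by
    intro x
    rw [Matrix.star_mulVec, Matrix.conjTranspose_conjTranspose, ← Matrix.dotProduct_mulVec,
      Matrix.mulVec_mulVec, Matrix.mulVec_mulVec]
    simp only [dotProduct, Matrix.mulVec, Finset.mul_sum, Pi.star_apply]
  have hi : ∀ i j, MeasureTheory.Integrable (fun x : ℝ => star (v i) *
      ((evalAt P (x : ℂ) * W x * (evalAt P (x : ℂ)).conjTranspose) i j * v j)) := fun i j =>
    ((hW.integrable_mip P P i j).mul_const (v j)).const_mul (star (v i))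
  simp only [he]
  refine ⟨MeasureTheory.integrable_finsetSum _ fun i _ =>
    MeasureTheory.integrable_finsetSum _ fun j _ => hi i j, ?_⟩
  rw [MeasureTheory.integral_finsetSum _ fun i _ =>
    MeasureTheory.integrable_finsetSum _ fun j _ => hi i j]
  simp only [dotProduct, Matrix.mulVec, Finset.mul_sum, Pi.star_apply]
  refine Finset.sum_congr rfl fun i _ => ?_
  rw [MeasureTheory.integral_finsetSum _ fun j _ => hi i j]
  refine Finset.sum_congr rfl fun j _ => ?_
  rw [MeasureTheory.integral_const_mul, MeasureTheory.integral_mul_const, mip_apply]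

theorem dotProduct_mip_mulVec_nonneg (hW : IsMatrixWeight W) (P : (Mat N)[X]) (v : Fin N → ℂ) :
    0 ≤ dotProduct (star v) ((mip W P P).mulVec v) := by
  rw [(dotProduct_mip_mulVec hW P v).2]
  exact MeasureTheory.integral_nonneg fun x => (hW.posDef x).posSemidef.dotProduct_mulVec_nonneg _

/-- A nonnegative integrand with zero integral vanishes almost everywhere, so `P(x)* v = 0` almost
everywhere as `W` is definite. Continuity extends this to every real `x`, and a polynomial with
infinitely many roots is zero. -/
theorem coeff_conjTranspose_mulVec_eq_zero (hW : IsMatrixWeight W) {P : (Mat N)[X]}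
    {v : Fin N → ℂ} (hv : dotProduct (star v) ((mip W P P).mulVec v) = 0) (k : ℕ) :
    (P.coeff k).conjTranspose.mulVec v = 0 := by
  obtain ⟨hint, heq⟩ := dotProduct_mip_mulVec hW P v
  have hnn : ∀ x : ℝ, 0 ≤ dotProduct (star ((evalAt P (x : ℂ)).conjTranspose.mulVec v))
        ((W x).mulVec ((evalAt P (x : ℂ)).conjTranspose.mulVec v)) := fun x =>
    (hW.posDef x).posSemidef.dotProduct_mulVec_nonneg _
  have hre := congrArg Complex.re (heq.symm.trans hv)
  rw [← RCLike.re_eq_complex_re, ← integral_re hint, RCLike.re_eq_complex_re, Complex.zero_re,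
    MeasureTheory.integral_eq_zero_iff_of_nonneg
      (fun x => (Complex.nonneg_iff.mp (hnn x)).1) hint.re] at hre
  have hae : ∀ᵐ x : ℝ, (evalAt P (x : ℂ)).conjTranspose.mulVec v = 0 := by
    filter_upwards [hre] with x hx
    by_contra hne
    have := (Complex.pos_iff.mp ((hW.posDef x).dotProduct_mulVec_pos hne)).1
    exact this.ne' hx
  choose p hp hpc using fun i j => exists_entry_polynomial P i j
  ext i
  -- The polynomial agreeing on the real line with the `i`-th entry of `P(x)* v`.
  let r : ℂ[X] := ∑ j, (p j i).map (starRingEnd ℂ) * C (v j)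
  have hr : ∀ x : ℝ, r.eval (x : ℂ) = (evalAt P (x : ℂ)).conjTranspose.mulVec v i := fun x => by
    simp only [r, eval_finsetSum, eval_mul, eval_C, ← star_eval_ofReal, Matrix.mulVec, dotProduct,
      Matrix.conjTranspose_apply, hp]
  have hz : (fun x : ℝ => r.eval (x : ℂ)) = fun _ => 0 := by
    refine (Continuous.ae_eq_iff_eq MeasureTheory.volume
      (r.continuous.comp Complex.continuous_ofReal) continuous_const).mp ?_
    filter_upwards [hae] with x hx
    rw [Function.comp_apply, hr, hx, Pi.zero_apply]
  have hr0 : r = 0 := r.eq_zero_of_infinite_isRoot <|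
    (Set.infinite_range_of_injective Complex.ofReal_injective).mono <| by
      rintro _ ⟨x, rfl⟩
      exact congrFun hz x
  have hc := congrArg (fun q => q.coeff k) hr0
  simp only [r, finsetSum_coeff, coeff_mul_C, coeff_map, coeff_zero] at hc
  simp only [Matrix.mulVec, dotProduct, Matrix.conjTranspose_apply, hpc, Pi.zero_apply]
  exact hc

theorem isUnit_mip_self (hW : IsMatrixWeight W) {P : (Mat N)[X]} {n : ℕ} (hP : P.coeff n = 1) :
    IsUnit (mip W P P) := by
  have hpd : (mip W P P).PosDef := by
    refine .of_dotProduct_mulVec_pos (conjTranspose_mip hW P P) fun v hv => ?_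
    refine lt_of_le_of_ne (dotProduct_mip_mulVec_nonneg hW P v) fun h => hv ?_
    have := coeff_conjTranspose_mulVec_eq_zero hW h.symm n
    rwa [hP, Matrix.conjTranspose_one, Matrix.one_mulVec] at this
  exact hpd.isUnit

theorem eq_zero_of_mip_self_eq_zero (hW : IsMatrixWeight W) {P : (Mat N)[X]}
    (hP : mip W P P = 0) : P = 0 := by
  ext1 k
  refine Matrix.conjTranspose_eq_zero.mp ?_
  refine Matrix.ext_of_mulVec_single fun j => ?_
  rw [coeff_conjTranspose_mulVec_eq_zero hW (by rw [hP, Matrix.zero_mulVec, dotProduct_zero]) k,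
    Matrix.zero_mulVec]

end Form

/-! ### Orthogonality and the three-term recurrence. -/

section OrthogonalPolynomials

variable {N : ℕ} {W : ℝ → Mat N}

theorem monicOP_spec (hW : IsMatrixWeight W) (n : ℕ) :
    (monicOP W n).coeff n = 1 ∧ (∀ k, n < k → (monicOP W n).coeff k = 0) ∧
      ∀ l < n, mip W (monicOP W n) (monicOP W l) = 0 := by
  induction n using Nat.strong_induction_on with
  | _ n ih =>
    have hlow : ∀ (k : Fin n) (A : Mat N) (j : ℕ), n ≤ j → (C A * monicOP W k).coeff j = 0 := by
      intro k A j hj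
      rw [coeff_C_mul, (ih k k.isLt).2.1 j (k.isLt.trans_le hj), mul_zero]
    refine ⟨?_, fun k hk => ?_, fun l hl => ?_⟩
    · rw [monicOP, coeff_sub, finsetSum_coeff, Finset.sum_eq_zero fun k _ => hlow k _ n le_rfl,
        coeff_X_pow_self, sub_zero]
    · rw [monicOP, coeff_sub, finsetSum_coeff, Finset.sum_eq_zero fun j _ => hlow j _ k hk.le,
        coeff_X_pow, if_neg hk.ne', sub_zero]
    · rw [monicOP, mip_sub_left hW, mip_sum_left hW, Finset.sum_eq_single ⟨l, hl⟩]
      · have hu := (Matrix.isUnit_iff_isUnit_det _).mp (isUnit_mip_self hW (ih l hl).1)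
        rw [mip_C_mul_left hW, Matrix.mul_assoc, Matrix.nonsing_inv_mul _ hu, mul_one, sub_self]
      · intro k _ hk
        have hkl : (k : ℕ) ≠ l := fun h => hk (Fin.ext h)
        rw [mip_C_mul_left hW]
        rcases lt_or_gt_of_ne hkl with h | h
        · rw [← conjTranspose_mip hW (monicOP W l), (ih l hl).2.2 k h, Matrix.conjTranspose_zero,
            mul_zero]
        · rw [(ih k k.isLt).2.2 l h, mul_zero]
      · exact fun h => absurd (Finset.mem_univ _) h

theorem monicOP_coeff_self (hW : IsMatrixWeight W) (n : ℕ) : (monicOP W n).coeff n = 1 :=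
  (monicOP_spec hW n).1

theorem monicOP_coeff_of_lt (hW : IsMatrixWeight W) {n k : ℕ} (h : n < k) :
    (monicOP W n).coeff k = 0 := (monicOP_spec hW n).2.1 k h

/-- Subtracting a left multiple of `monicOP W d` removes the top coefficient of `Q`, so induction on
the degree bound reduces to orthogonality among the `monicOP`. -/
theorem mip_monicOP_eq_zero (hW : IsMatrixWeight W) {n d : ℕ} (hd : d ≤ n) {Q : (Mat N)[X]}
    (hQ : ∀ k, d ≤ k → Q.coeff k = 0) : mip W (monicOP W n) Q = 0 := by
  induction d generalizing Q with
  | zero =>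
    have : Q = 0 := by
      ext1 k
      rw [hQ k k.zero_le, coeff_zero]
    rw [this, mip_zero_right hW]
  | succ d ih =>
    have h : mip W (monicOP W n) (Q - C (Q.coeff d) * monicOP W d) = 0 := by
      refine ih (by omega) fun k hk => ?_
      rw [coeff_sub, coeff_C_mul]
      rcases hk.eq_or_lt with rfl | hk
      · rw [monicOP_coeff_self hW, mul_one, sub_self]
      · rw [hQ k hk, monicOP_coeff_of_lt hW hk, mul_zero, sub_zero]
    rwa [mip_sub_right hW, mip_C_mul_right hW, (monicOP_spec hW n).2.2 d (by omega), zero_mul,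
      sub_zero] at h

theorem mip_monicOP_right_eq_zero (hW : IsMatrixWeight W) {n d : ℕ} (hd : d ≤ n) {Q : (Mat N)[X]}
    (hQ : ∀ k, d ≤ k → Q.coeff k = 0) : mip W Q (monicOP W n) = 0 := by
  rw [← conjTranspose_mip hW, mip_monicOP_eq_zero hW hd hQ, Matrix.conjTranspose_zero]

theorem mip_monicOP_right (hW : IsMatrixWeight W) {n : ℕ} {Q : (Mat N)[X]}
    (hQ : ∀ k, n < k → Q.coeff k = 0) :
    mip W Q (monicOP W n) = Q.coeff n * mip W (monicOP W n) (monicOP W n) := by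
  have h : mip W (Q - C (Q.coeff n) * monicOP W n) (monicOP W n) = 0 := by
    refine mip_monicOP_right_eq_zero hW le_rfl fun k hk => ?_
    rw [coeff_sub, coeff_C_mul]
    rcases hk.eq_or_lt with rfl | hk
    · rw [monicOP_coeff_self hW, mul_one, sub_self]
    · rw [hQ k hk, monicOP_coeff_of_lt hW hk, mul_zero, sub_zero]
  rwa [mip_sub_left hW, mip_C_mul_left hW, sub_eq_zero] at h

theorem isMonicMOPRL_monicOP (hW : IsMatrixWeight W) : IsMonicMOPRL W (monicOP W) := fun n =>
  ⟨monicOP_coeff_self hW n, fun _ => monicOP_coeff_of_lt hW, fun _ => mip_monicOP_eq_zero hW le_rfl⟩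

theorem monicOP_zero : monicOP W 0 = 1 := by
  rw [monicOP]
  simp

theorem mip_monicOP_of_ne (hW : IsMatrixWeight W) {n l : ℕ} (h : n ≠ l) :
    mip W (monicOP W n) (monicOP W l) = 0 := by
  rcases lt_or_gt_of_ne h with h | h
  · exact mip_monicOP_right_eq_zero hW h fun k hk => monicOP_coeff_of_lt hW hk
  · exact mip_monicOP_eq_zero hW h fun k hk => monicOP_coeff_of_lt hW hk

theorem mip_mul_gammaCoeff (hW : IsMatrixWeight W) (n : ℕ) :
    mip W (monicOP W n) (monicOP W n) * gammaCoeff W n = 1 :=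
  Matrix.mul_nonsing_inv _ <| (Matrix.isUnit_iff_isUnit_det _).mp <|
    isUnit_mip_self hW (monicOP_coeff_self hW n)

theorem gammaCoeff_mul_mip (hW : IsMatrixWeight W) (n : ℕ) :
    gammaCoeff W n * mip W (monicOP W n) (monicOP W n) = 1 :=
  mul_eq_one_comm.mp (mip_mul_gammaCoeff hW n)

theorem gammaCoeff_inv (hW : IsMatrixWeight W) (n : ℕ) :
    (gammaCoeff W n)⁻¹ = mip W (monicOP W n) (monicOP W n) :=
  Matrix.inv_eq_right_inv (gammaCoeff_mul_mip hW n)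

theorem conjTranspose_gammaCoeff (hW : IsMatrixWeight W) (n : ℕ) :
    (gammaCoeff W n).conjTranspose = gammaCoeff W n := by
  rw [gammaCoeff, Matrix.conjTranspose_nonsing_inv, conjTranspose_mip hW]

theorem aCoeff_one_succ (n : ℕ) : aCoeff W (n + 1) 1 = (monicOP W (n + 1)).coeff n := by
  rw [aCoeff, if_pos (by omega), Nat.add_sub_cancel]

theorem monicOP_one (hW : IsMatrixWeight W) : monicOP W 1 = X - C (alphaCoeff W 0) := by
  ext1 k
  rw [alphaCoeff, aCoeff_one_succ, aCoeff, if_neg (by omega), zero_sub, coeff_sub, coeff_C]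
  rcases k with _ | _ | k
  · simp
  · simp [monicOP_coeff_self hW]
  · rw [monicOP_coeff_of_lt hW (by omega), coeff_X, if_neg (by omega), if_neg (by omega), sub_zero]

theorem X_mul_monicOP_zero (hW : IsMatrixWeight W) :
    X * monicOP W 0 = monicOP W 1 + C (alphaCoeff W 0) * monicOP W 0 := by
  rw [monicOP_one hW, monicOP_zero, mul_one, mul_one, sub_add_cancel]

/-- The choice of `alphaCoeff` brings the defect `Q` down to degree at most `n`, and that of
`betaCoeff` removes its coefficient at `n`. Then every term of `Q` is orthogonal to `Q`, so
definiteness forces `Q = 0`. -/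
theorem X_mul_monicOP_succ (hW : IsMatrixWeight W) (n : ℕ) :
    X * monicOP W (n + 1) =
      monicOP W (n + 2) + C (alphaCoeff W (n + 1)) * monicOP W (n + 1) +
        C (betaCoeff W (n + 1)) * monicOP W n := by
  set Q := X * monicOP W (n + 1) - (monicOP W (n + 2) +
    C (alphaCoeff W (n + 1)) * monicOP W (n + 1) + C (betaCoeff W (n + 1)) * monicOP W n) with hQ
  have hdeg : ∀ k, n < k → Q.coeff k = 0 := by
    intro k hk
    obtain ⟨k, rfl⟩ := Nat.exists_eq_succ_of_ne_zero (by omega : k ≠ 0)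
    simp only [hQ, coeff_sub, coeff_add, coeff_C_mul, coeff_X_mul, Nat.succ_eq_add_one]
    rw [monicOP_coeff_of_lt hW (n := n) (by omega), mul_zero, add_zero]
    rcases (by omega : k = n ∨ k = n + 1 ∨ n + 1 < k) with rfl | rfl | h
    · rw [alphaCoeff, aCoeff_one_succ, aCoeff_one_succ, monicOP_coeff_self hW,
        mul_one, add_sub_cancel, sub_self]
    · rw [monicOP_coeff_self hW, monicOP_coeff_self hW, monicOP_coeff_of_lt hW (by omega)]
      simp
    · rw [monicOP_coeff_of_lt hW h, monicOP_coeff_of_lt hW (by omega),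
        monicOP_coeff_of_lt hW (by omega)]
      simp
  have hX : mip W (X * monicOP W (n + 1)) (monicOP W n) =
      mip W (monicOP W (n + 1)) (monicOP W (n + 1)) := by
    rw [mip_X_mul_left, ← conjTranspose_mip hW, mip_monicOP_right hW, coeff_X_mul,
      monicOP_coeff_self hW, one_mul, conjTranspose_mip hW]
    intro k hk
    obtain ⟨k, rfl⟩ := Nat.exists_eq_succ_of_ne_zero (by omega : k ≠ 0)
    rw [Nat.succ_eq_add_one, coeff_X_mul, monicOP_coeff_of_lt hW (by omega)]
  have hn : mip W Q (monicOP W n) = 0 := by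
    rw [hQ, mip_sub_left hW, mip_add_left hW, mip_add_left hW, mip_C_mul_left hW,
      mip_C_mul_left hW, hX, mip_monicOP_of_ne hW (n := n + 2) (l := n) (by omega),
      mip_monicOP_of_ne hW (n := n + 1) (l := n) (by omega),
      betaCoeff, gammaCoeff_inv hW, Matrix.mul_assoc, gammaCoeff_mul_mip hW]
    simp
  have hcn : Q.coeff n = 0 := by
    rw [mip_monicOP_right hW hdeg] at hn
    rw [← mul_one (Q.coeff n), ← mip_mul_gammaCoeff hW n, ← mul_assoc, hn, zero_mul]
  have hlow : ∀ k, n ≤ k → Q.coeff k = 0 := fun k hk =>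
    hk.eq_or_lt.elim (fun h => h ▸ hcn) (hdeg k)
  -- Moving `X` to the right raises the degree of `Q` to at most `n`, still below `n + 1`.
  have hXQ : mip W (X * monicOP W (n + 1)) Q = 0 := by
    rw [mip_X_mul_left]
    refine mip_monicOP_eq_zero hW le_rfl fun k hk => ?_
    obtain ⟨k, rfl⟩ := Nat.exists_eq_succ_of_ne_zero (by omega : k ≠ 0)
    rw [Nat.succ_eq_add_one, coeff_X_mul, hlow k (by omega)]
  have hQQ : mip W Q Q = 0 := by
    conv_lhs => rw [hQ]
    rw [mip_sub_left hW, mip_add_left hW, mip_add_left hW, mip_C_mul_left hW, mip_C_mul_left hW,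
      hXQ, mip_monicOP_eq_zero hW (by omega) hlow, mip_monicOP_eq_zero hW (by omega) hlow,
      mip_monicOP_eq_zero hW le_rfl hlow]
    simp
  exact sub_eq_zero.mp (eq_zero_of_mip_self_eq_zero hW hQQ)

theorem alphaCoeff_mul_mip (hW : IsMatrixWeight W) (n : ℕ) :
    mip W (X * monicOP W n) (monicOP W n) =
      alphaCoeff W n * mip W (monicOP W n) (monicOP W n) := by
  cases n with
  | zero =>
    rw [X_mul_monicOP_zero hW, mip_add_left hW, mip_C_mul_left hW,
      mip_monicOP_of_ne hW (by omega), zero_add]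
  | succ n =>
    rw [X_mul_monicOP_succ hW, mip_add_left hW, mip_add_left hW, mip_C_mul_left hW,
      mip_C_mul_left hW, mip_monicOP_of_ne hW (n := n + 2) (l := n + 1) (by omega),
      mip_monicOP_of_ne hW (n := n) (l := n + 1) (by omega),
      zero_add, mul_zero, add_zero]

/-- Multiplication by the real variable is symmetric, so `αₙ γₙ⁻¹` is Hermitian. -/
theorem conjTranspose_alphaCoeff_mul (hW : IsMatrixWeight W) (n : ℕ) :
    (alphaCoeff W n).conjTranspose * gammaCoeff W n = gammaCoeff W n * alphaCoeff W n := by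
  have h : mip W (monicOP W n) (monicOP W n) * (alphaCoeff W n).conjTranspose =
      alphaCoeff W n * mip W (monicOP W n) (monicOP W n) := by
    conv_lhs => rw [← conjTranspose_mip hW]
    rw [← Matrix.conjTranspose_mul, ← alphaCoeff_mul_mip hW, conjTranspose_mip hW, mip_X_mul_left]
  calc (alphaCoeff W n).conjTranspose * gammaCoeff W n
      = gammaCoeff W n * (mip W (monicOP W n) (monicOP W n) * (alphaCoeff W n).conjTranspose) *
          gammaCoeff W n := by rw [← mul_assoc, gammaCoeff_mul_mip hW, one_mul]
    _ = gammaCoeff W n * alphaCoeff W n := by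
      rw [h, mul_assoc, mul_assoc, mip_mul_gammaCoeff hW, mul_one]

theorem conjTranspose_betaCoeff_mul (hW : IsMatrixWeight W) (n : ℕ) :
    (betaCoeff W (n + 1)).conjTranspose * gammaCoeff W (n + 1) = gammaCoeff W n := by
  rw [betaCoeff, Matrix.conjTranspose_mul, gammaCoeff_inv hW, conjTranspose_mip hW,
    conjTranspose_gammaCoeff hW, mul_assoc, mip_mul_gammaCoeff hW, mul_one]

theorem mip_derivative_monicOP_succ (hW : IsMatrixWeight W) (n : ℕ) :
    mip W (derivative (monicOP W (n + 1))) (monicOP W n) =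
      (n + 1) * mip W (monicOP W n) (monicOP W n) := by
  rw [mip_monicOP_right hW, coeff_derivative, monicOP_coeff_self hW, one_mul]
  intro k hk
  rw [coeff_derivative, monicOP_coeff_of_lt hW (by omega), zero_mul]

theorem mip_monicOP_derivative (hW : IsMatrixWeight W) {n l : ℕ} (h : l ≤ n) :
    mip W (monicOP W n) (derivative (monicOP W l)) = 0 := by
  refine mip_monicOP_eq_zero hW h fun k hk => ?_
  rw [coeff_derivative, monicOP_coeff_of_lt hW (by omega), zero_mul]

theorem mip_derivative_monicOP (hW : IsMatrixWeight W) {n l : ℕ} (h : l ≤ n) :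
    mip W (derivative (monicOP W l)) (monicOP W n) = 0 := by
  rw [← conjTranspose_mip hW, mip_monicOP_derivative hW h, Matrix.conjTranspose_zero]

theorem mip_monicOP_succ_one (hW : IsMatrixWeight W) (n : ℕ) :
    mip W (monicOP W (n + 1)) 1 = 0 := by
  refine mip_monicOP_eq_zero hW (Nat.succ_le_succ n.zero_le) fun k hk => ?_
  rw [coeff_one, if_neg (by omega)]

theorem mip_one_monicOP_succ (hW : IsMatrixWeight W) (n : ℕ) :
    mip W 1 (monicOP W (n + 1)) = 0 := by
  rw [← conjTranspose_mip hW, mip_monicOP_succ_one hW, Matrix.conjTranspose_zero]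

end OrthogonalPolynomials

/-! ### The sesquilinear form behind `𝒜ₙ` and `ℬₙ`. -/

section CompatibilityForm

variable {N : ℕ} {W : ℝ → Mat N}

/-- The sesquilinear form `(D_z(P G), Q)_W + (P, D_{z̄}(Q G))_W`, where `D_z` is the divided
difference at `z`; up to factors `γₙ`, its values on the monic orthogonal polynomials are the
coefficients `𝒜ₙ` and `ℬₙ`. -/
noncomputable def compatForm (W : ℝ → Mat N) (G : (Mat N)[X]) (z : ℂ) (P Q : (Mat N)[X]) : Mat N :=
  mip W (dividedDiff z (P * G)) Q + mip W P (dividedDiff (starRingEnd ℂ z) (Q * G))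

theorem conjTranspose_compatForm (hW : IsMatrixWeight W) (G : (Mat N)[X]) (z : ℂ)
    (P Q : (Mat N)[X]) :
    (compatForm W G (starRingEnd ℂ z) P Q).conjTranspose = compatForm W G z Q P := by
  rw [compatForm, compatForm, Matrix.conjTranspose_add, conjTranspose_mip hW,
    conjTranspose_mip hW, starRingEnd_self_apply, add_comm]

theorem compatForm_add_left (hW : IsMatrixWeight W) (G : (Mat N)[X]) (z : ℂ)
    (P₁ P₂ Q : (Mat N)[X]) :
    compatForm W G z (P₁ + P₂) Q = compatForm W G z P₁ Q + compatForm W G z P₂ Q := by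
  simp only [compatForm, add_mul, dividedDiff_add, mip_add_left hW]
  abel

theorem compatForm_C_mul_left (hW : IsMatrixWeight W) (G : (Mat N)[X]) (z : ℂ) (A : Mat N)
    (P Q : (Mat N)[X]) : compatForm W G z (C A * P) Q = A * compatForm W G z P Q := by
  simp only [compatForm, mul_assoc, dividedDiff_C_mul, mip_C_mul_left hW, mul_add]

theorem compatForm_add_right (hW : IsMatrixWeight W) (G : (Mat N)[X]) (z : ℂ)
    (P Q₁ Q₂ : (Mat N)[X]) :
    compatForm W G z P (Q₁ + Q₂) = compatForm W G z P Q₁ + compatForm W G z P Q₂ := by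
  simp only [compatForm, add_mul, dividedDiff_add, mip_add_right hW]
  abel

theorem compatForm_C_mul_right (hW : IsMatrixWeight W) (G : (Mat N)[X]) (z : ℂ) (A : Mat N)
    (P Q : (Mat N)[X]) :
    compatForm W G z P (C A * Q) = compatForm W G z P Q * A.conjTranspose := by
  simp only [compatForm, mul_assoc, dividedDiff_C_mul, mip_C_mul_right hW, add_mul]

/-- Moving `X` through each divided difference leaves `(PG, Q) + (P, QG)`, which integration by
parts trades for derivative terms. Only the second summand, where `X` crosses the form first, yields
a boundary value. -/
theorem compatForm_X_mul_left (hW : IsMatrixWeight W) {T : ℝ → Mat N} {G : (Mat N)[X]}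
    (hWT : ∀ x : ℝ, W x = T x * (T x).conjTranspose)
    (hTG : ∀ (x : ℝ) (i j : Fin N),
      HasDerivAt (fun t : ℝ => T t i j) ((evalAt G (x : ℂ) * T x) i j) x)
    (z : ℂ) (P Q : (Mat N)[X]) :
    compatForm W G z (X * P) Q = Matrix.scalar (Fin N) z * compatForm W G z P Q -
      mip W (derivative P) Q - mip W P (derivative Q) -
        mip W P 1 * (evalAt (Q * G) (starRingEnd ℂ z)).conjTranspose := by
  have h := mip_derivative_add hW hWT hTG P Q
  have hc := (Matrix.scalar_commute z (fun _ => Commute.all _ _)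
    (mip W P (dividedDiff (starRingEnd ℂ z) (Q * G)))).eq
  have hone : mip W P (C (evalAt (Q * G) (starRingEnd ℂ z))) =
      mip W P 1 * (evalAt (Q * G) (starRingEnd ℂ z)).conjTranspose := by
    rw [← mip_C_mul_right hW, mul_one]
  rw [compatForm, compatForm, mul_assoc, dividedDiff_X_mul, mip_add_left hW, mip_C_mul_left hW,
    mip_X_mul_left, X_mul_dividedDiff, mip_sub_right hW, mip_add_right hW, mip_C_mul_right hW,
    conjTranspose_scalar, starRingEnd_self_apply, hone, ← hc, mul_add,
    eq_neg_of_add_eq_zero_right h]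
  abel

theorem compatForm_X_mul_right (hW : IsMatrixWeight W) {T : ℝ → Mat N} {G : (Mat N)[X]}
    (hWT : ∀ x : ℝ, W x = T x * (T x).conjTranspose)
    (hTG : ∀ (x : ℝ) (i j : Fin N),
      HasDerivAt (fun t : ℝ => T t i j) ((evalAt G (x : ℂ) * T x) i j) x)
    (z : ℂ) (P Q : (Mat N)[X]) :
    compatForm W G z P (X * Q) = compatForm W G z P Q * Matrix.scalar (Fin N) z -
      mip W (derivative P) Q - mip W P (derivative Q) - evalAt (P * G) z * mip W 1 Q := by
  rw [← conjTranspose_compatForm hW, compatForm_X_mul_left hW hWT hTG]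
  simp only [Matrix.conjTranspose_sub, Matrix.conjTranspose_mul, conjTranspose_compatForm hW,
    conjTranspose_mip hW, conjTranspose_scalar, starRingEnd_self_apply,
    Matrix.conjTranspose_conjTranspose]
  abel

end CompatibilityForm

/-! ### Identification of the explicit coefficients with values of the form. -/

section Coefficients

variable {N : ℕ} {W : ℝ → Mat N}

theorem bCoeff_eq_mip (n k : ℕ) : bCoeff W n k = mip W (monicOP W n) (X ^ k) := by
  simp only [bCoeff, mip, evalAt_X_pow, Matrix.conjTranspose_smul, Matrix.conjTranspose_one,
    mul_smul_comm, mul_one, star_pow, Complex.star_def, Complex.conj_ofReal]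

theorem dividedDiff_monomial_coeff (z : ℂ) (t : ℕ) (A : Mat N) (k : ℕ) :
    (dividedDiff z (monomial t A)).coeff k = if k < t then z ^ (t - (k + 1)) • A else 0 := by
  induction t generalizing k with
  | zero =>
    have h : (0 : (Mat N)[X]) = dividedDiff z (monomial 0 A) := eq_dividedDiff (by
      rw [evalAt_monomial, pow_zero, one_smul, mul_zero, monomial_zero_left, sub_self])
    rw [← h, if_neg (by omega), coeff_zero]
  | succ t ih =>
    rw [← X_mul_monomial, dividedDiff_X_mul, coeff_add, coeff_C_mul, ih, coeff_monomial,
      scalar_mul_eq_smul]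
    rcases lt_trichotomy k t with h | rfl | h
    · rw [if_pos h, if_neg (by omega), if_pos (by omega), smul_smul, ← pow_succ', add_zero]
      congr 2
      omega
    · simp
    · rw [if_neg (by omega), if_neg (by omega), if_neg (by omega), smul_zero, add_zero]

/-- The divided difference at `z`, as an additive map. -/
noncomputable def dividedDiffHom (z : ℂ) : (Mat N)[X] →+ (Mat N)[X] :=
  AddMonoidHom.mk' (dividedDiff z) (dividedDiff_add z)

theorem dividedDiff_sum (z : ℂ) {ι : Type*} (s : Finset ι) (F : ι → (Mat N)[X]) :
    dividedDiff z (∑ i ∈ s, F i) = ∑ i ∈ s, dividedDiff z (F i) :=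
  map_sum (dividedDiffHom z) F s

theorem eq_sum_range_monomial {d : ℕ} {Q : (Mat N)[X]} (hQ : ∀ k, d ≤ k → Q.coeff k = 0) :
    Q = ∑ k ∈ Finset.range d, monomial k (Q.coeff k) := by
  ext1 k
  simp only [finsetSum_coeff, coeff_monomial, Finset.sum_ite_eq', Finset.mem_range]
  split_ifs with h
  · rfl
  · exact hQ k (by omega)

theorem partialOP_eq (n k : ℕ) (z : ℂ) :
    partialOP W n k z = ∑ i ∈ Finset.range (n + 1),
      if i ≤ k then z ^ (k - i) • (monicOP W n).coeff (n - i) else 0 := by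
  simp only [partialOP, aCoeff, smul_ite, smul_zero]
  rw [← Finset.sum_filter, ← Finset.sum_filter]
  refine Finset.sum_congr ?_ fun _ _ => rfl
  ext i
  simp only [Finset.mem_filter, Finset.mem_range]
  omega

/-- Expand `P n * G` into monomials and use `(xᵗ - zᵗ) / (x - z) = ∑_{k<t} z^(t-1-k) xᵏ`. Stating
the index relation additively avoids truncated subtraction. -/
theorem deltaOP_eq_coeff (hW : IsMatrixWeight W) (G : (Mat N)[X]) {j n k : ℕ} (z : ℂ)
    (hj : j ≤ G.natDegree) (hk : k + j + 1 = n + G.natDegree) :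
    deltaOP W G j n z = (dividedDiff z (monicOP W n * G)).coeff k := by
  have hP := eq_sum_range_monomial (d := n + 1) (Q := monicOP W n)
    fun k hk => monicOP_coeff_of_lt hW hk
  have hG := eq_sum_range_monomial (d := G.natDegree + 1) (Q := G)
    fun k hk => coeff_eq_zero_of_natDegree_lt hk
  have hF : monicOP W n * G = ∑ b ∈ Finset.range (G.natDegree + 1),
      ∑ i ∈ Finset.range (n + 1),
        monomial (n - i + b) ((monicOP W n).coeff (n - i) * G.coeff b) := by
    conv_lhs => rw [hG, hP, ← Finset.sum_range_reflect, Finset.sum_mul_sum, Finset.sum_comm]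
    refine Finset.sum_congr rfl fun b _ => Finset.sum_congr rfl fun i _ => ?_
    rw [monomial_mul_monomial, Nat.add_sub_cancel]
  rw [hF]
  simp only [dividedDiff_sum, finsetSum_coeff, dividedDiff_monomial_coeff]
  -- Coefficients of `G` below index `m - j` give monomials of degree at most `k`, which do not
  -- reach the coefficient of `xᵏ`.
  rw [show G.natDegree + 1 = (G.natDegree - j) + (j + 1) by omega, Finset.sum_range_add,
    Finset.sum_eq_zero, zero_add, deltaOP]
  · refine Finset.sum_congr rfl fun l _ => ?_
    rw [partialOP_eq, Finset.sum_mul]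
    refine Finset.sum_congr rfl fun i hi => ?_
    rw [Finset.mem_range] at hi
    by_cases h : i ≤ l
    · rw [if_pos h, if_pos (by omega), smul_mul_assoc]
      congr 2
      omega
    · rw [if_neg h, if_neg (by omega), zero_mul]
  · intro b hb
    rw [Finset.mem_range] at hb
    exact Finset.sum_eq_zero fun i _ => if_neg (by omega)

theorem dividedDiff_coeff_eq_zero {d : ℕ} {F : (Mat N)[X]} (hF : ∀ k, d < k → F.coeff k = 0)
    (z : ℂ) {k : ℕ} (hk : d ≤ k) : (dividedDiff z F).coeff k = 0 := by
  rw [dividedDiff, coeff_divByMonic_X_sub_C]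
  refine Finset.sum_eq_zero fun i hi => ?_
  rw [Finset.mem_Icc] at hi
  rw [hF i (by omega), mul_zero]

/-- Powers below `s ≤ q` are orthogonal to `monicOP W q`, so `r` coefficients remain, listed from
the top down to match the index of `deltaOP`. A free `s` lets both sums of `coeffB` start at the
same power. -/
theorem mip_dividedDiff_monicOP (hW : IsMatrixWeight W) (G : (Mat N)[X]) (z : ℂ) {p q s r : ℕ}
    (hs : s ≤ q) (hr : s + r = p + G.natDegree) :
    mip W (dividedDiff z (monicOP W p * G)) (monicOP W q) =
      ∑ j ∈ Finset.range r, (dividedDiff z (monicOP W p * G)).coeff (s + (r - 1 - j)) *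
        (bCoeff W q (s + (r - 1 - j))).conjTranspose := by
  have hF : ∀ k, p + G.natDegree < k → (monicOP W p * G).coeff k = 0 := by
    intro k hk
    rw [coeff_mul]
    refine Finset.sum_eq_zero fun x hx => ?_
    have hx := Finset.HasAntidiagonal.mem_antidiagonal.mp hx
    by_cases h : p < x.1
    · rw [monicOP_coeff_of_lt hW h, zero_mul]
    · rw [coeff_eq_zero_of_natDegree_lt (p := G) (by omega), mul_zero]
  have h := eq_sum_range_monomial (d := s + r) (Q := dividedDiff z (monicOP W p * G))
    fun k hk => dividedDiff_coeff_eq_zero hF z (by omega)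
  have hterm : ∀ k, mip W (monomial k ((dividedDiff z (monicOP W p * G)).coeff k))
      (monicOP W q) = (dividedDiff z (monicOP W p * G)).coeff k *
        (bCoeff W q k).conjTranspose := by
    intro k
    rw [← C_mul_X_pow_eq_monomial, mip_C_mul_left hW, bCoeff_eq_mip, conjTranspose_mip hW]
  conv_lhs => rw [h]
  rw [mip_sum_left hW, Finset.sum_range_add, Finset.sum_eq_zero, zero_add,
    ← Finset.sum_range_reflect]
  · exact Finset.sum_congr rfl fun _ _ => hterm _
  · intro k hk
    rw [Finset.mem_range] at hk
    refine mip_monicOP_right_eq_zero hW (d := k + 1) (by omega) fun l hl => ?_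
    rw [coeff_monomial, if_neg (by omega)]

theorem coeffA_eq (hW : IsMatrixWeight W) (G : (Mat N)[X]) (n : ℕ) (z : ℂ) :
    coeffA W G n z =
      -(gammaCoeff W n * compatForm W G z (monicOP W n) (monicOP W n)) := by
  rw [coeffA, compatForm, ← conjTranspose_mip hW (dividedDiff _ _),
    mip_dividedDiff_monicOP hW G z le_rfl rfl, mip_dividedDiff_monicOP hW G _ le_rfl rfl,
    Matrix.conjTranspose_sum, ← Finset.sum_add_distrib]
  congr 2
  refine Finset.sum_congr rfl fun j hj => ?_
  rw [Finset.mem_range] at hj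
  have hk : n + G.natDegree - j - 1 = n + (G.natDegree - 1 - j) := by omega
  rw [conjStar, deltaOP_eq_coeff hW G (k := n + (G.natDegree - 1 - j)) _ hj.le (by omega),
    deltaOP_eq_coeff hW G (k := n + (G.natDegree - 1 - j)) _ hj.le (by omega), hk,
    Matrix.conjTranspose_mul, Matrix.conjTranspose_conjTranspose, add_comm]

theorem conjStar_coeffA (hW : IsMatrixWeight W) (G : (Mat N)[X]) (n : ℕ) (z : ℂ) :
    conjStar (coeffA W G n) z =
      -(compatForm W G z (monicOP W n) (monicOP W n) * gammaCoeff W n) := by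
  rw [conjStar, coeffA_eq hW, Matrix.conjTranspose_neg, Matrix.conjTranspose_mul,
    conjTranspose_compatForm hW, conjTranspose_gammaCoeff hW]

theorem coeffB_succ (hW : IsMatrixWeight W) (G : (Mat N)[X]) (n : ℕ) (z : ℂ) :
    coeffB W G (n + 1) z =
      -(compatForm W G z (monicOP W (n + 1)) (monicOP W n) * gammaCoeff W n) := by
  rw [coeffB, compatForm, ← conjTranspose_mip hW (dividedDiff _ _),
    mip_dividedDiff_monicOP hW G z (s := n) (r := G.natDegree + 1) le_rfl (by omega),
    mip_dividedDiff_monicOP hW G _ (s := n) (r := G.natDegree) (by omega) rfl,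
    Matrix.conjTranspose_sum, neg_mul]
  congr 3
  · refine Finset.sum_congr rfl fun j hj => ?_
    rw [Finset.mem_range] at hj
    rw [deltaOP_eq_coeff hW G (k := n + (G.natDegree + 1 - 1 - j)) _ (by omega) (by omega)]
    congr 3
    omega
  · refine Finset.sum_congr rfl fun j hj => ?_
    rw [Finset.mem_range] at hj
    rw [conjStar, deltaOP_eq_coeff hW G (k := n + (G.natDegree - 1 - j)) _ hj.le (by omega),
      Matrix.conjTranspose_mul, Matrix.conjTranspose_conjTranspose]
    congr 2
    omega

end Coefficients

/-! ### The compatibility conditions. -/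

section Compatibility

variable {N : ℕ} {W T : ℝ → Mat N} {G : (Mat N)[X]}

theorem compatForm_monicOP_one (hW : IsMatrixWeight W)
    (hWT : ∀ x : ℝ, W x = T x * (T x).conjTranspose)
    (hTG : ∀ (x : ℝ) (i j : Fin N),
      HasDerivAt (fun t : ℝ => T t i j) ((evalAt G (x : ℂ) * T x) i j) x) (z : ℂ) :
    compatForm W G z (monicOP W 1) (monicOP W 0) =
      (Matrix.scalar (Fin N) z - alphaCoeff W 0) *
          compatForm W G z (monicOP W 0) (monicOP W 0) -
        mip W (monicOP W 0) (monicOP W 0) * conjStar (evalAt G) z := by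
  have h := compatForm_X_mul_left hW hWT hTG z (monicOP W 0) (monicOP W 0)
  rw [X_mul_monicOP_zero hW, compatForm_add_left hW, compatForm_C_mul_left hW,
    mip_derivative_monicOP hW le_rfl, mip_monicOP_derivative hW le_rfl] at h
  rw [eq_sub_of_add_eq h, sub_mul, conjStar]
  simp only [monicOP_zero, one_mul]
  abel

theorem compatForm_monicOP_succ_succ (hW : IsMatrixWeight W)
    (hWT : ∀ x : ℝ, W x = T x * (T x).conjTranspose)
    (hTG : ∀ (x : ℝ) (i j : Fin N),
      HasDerivAt (fun t : ℝ => T t i j) ((evalAt G (x : ℂ) * T x) i j) x) (n : ℕ) (z : ℂ) :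
    compatForm W G z (monicOP W (n + 2)) (monicOP W (n + 1)) +
        betaCoeff W (n + 1) * compatForm W G z (monicOP W n) (monicOP W (n + 1)) =
      (Matrix.scalar (Fin N) z - alphaCoeff W (n + 1)) *
        compatForm W G z (monicOP W (n + 1)) (monicOP W (n + 1)) := by
  have h := compatForm_X_mul_left hW hWT hTG z (monicOP W (n + 1)) (monicOP W (n + 1))
  rw [X_mul_monicOP_succ hW, compatForm_add_left hW, compatForm_add_left hW,
    compatForm_C_mul_left hW, compatForm_C_mul_left hW, mip_derivative_monicOP hW le_rfl,
    mip_monicOP_derivative hW le_rfl, mip_monicOP_succ_one hW, zero_mul, sub_zero, sub_zero,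
    sub_zero] at h
  rw [sub_mul, ← h]
  abel

/-- Up to sign and the right factor `γₙ`, this is the recurrence inserted into `S(x P n, P n)`. For
`n = 0` the boundary value `G*(z)` replaces the missing lower term. -/
theorem second_compatibility (hW : IsMatrixWeight W)
    (hWT : ∀ x : ℝ, W x = T x * (T x).conjTranspose)
    (hTG : ∀ (x : ℝ) (i j : Fin N),
      HasDerivAt (fun t : ℝ => T t i j) ((evalAt G (x : ℂ) * T x) i j) x) (n : ℕ) (z : ℂ) :
    coeffB W G (n + 1) z +
        (gammaCoeff W n)⁻¹ * conjStar (coeffB W G n) z * gammaCoeff W n =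
      (Matrix.scalar (Fin N) z - alphaCoeff W n) * conjStar (coeffA W G n) z := by
  rw [coeffB_succ hW, conjStar_coeffA hW]
  cases n with
  | zero =>
    have hB : conjStar (coeffB W G 0) z = -conjStar (evalAt G) z := by
      rw [conjStar, coeffB, Matrix.conjTranspose_neg, conjStar]
    rw [hB, compatForm_monicOP_one hW hWT hTG, gammaCoeff_inv hW]
    noncomm_ring
  | succ n =>
    have hB : conjStar (coeffB W G (n + 1)) z =
        -(gammaCoeff W n * compatForm W G z (monicOP W n) (monicOP W (n + 1))) := by
      rw [conjStar, coeffB_succ hW, Matrix.conjTranspose_neg, Matrix.conjTranspose_mul,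
        conjTranspose_compatForm hW, conjTranspose_gammaCoeff hW]
    have h := congrArg (fun A => -(A * gammaCoeff W (n + 1)))
      (compatForm_monicOP_succ_succ hW hWT hTG n z)
    simp only [betaCoeff] at h
    rw [hB]
    simp only [add_mul, neg_add, mul_neg, neg_mul, mul_assoc] at h ⊢
    exact h

theorem compatForm_succ_left (hW : IsMatrixWeight W)
    (hWT : ∀ x : ℝ, W x = T x * (T x).conjTranspose)
    (hTG : ∀ (x : ℝ) (i j : Fin N),
      HasDerivAt (fun t : ℝ => T t i j) ((evalAt G (x : ℂ) * T x) i j) x) (n : ℕ) (z : ℂ) :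
    compatForm W G z (monicOP W (n + 1 + 1)) (monicOP W n) * gammaCoeff W n +
        alphaCoeff W (n + 1) *
          (compatForm W G z (monicOP W (n + 1)) (monicOP W n) * gammaCoeff W n) +
        betaCoeff W (n + 1) *
          (compatForm W G z (monicOP W n) (monicOP W n) * gammaCoeff W n) =
      Matrix.scalar (Fin N) z *
        (compatForm W G z (monicOP W (n + 1)) (monicOP W n) * gammaCoeff W n) - (n + 1) := by
  have h := compatForm_X_mul_left hW hWT hTG z (monicOP W (n + 1)) (monicOP W n)
  rw [X_mul_monicOP_succ hW, compatForm_add_left hW, compatForm_add_left hW,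
    compatForm_C_mul_left hW, compatForm_C_mul_left hW, mip_derivative_monicOP_succ hW,
    mip_monicOP_derivative hW (Nat.le_succ n), mip_monicOP_succ_one hW, zero_mul, sub_zero,
    sub_zero] at h
  have h' := congrArg (· * gammaCoeff W n) h
  simp only [add_mul, sub_mul, mul_assoc, mip_mul_gammaCoeff hW] at h'
  rw [h']
  noncomm_ring

theorem compatForm_succ_right (hW : IsMatrixWeight W)
    (hWT : ∀ x : ℝ, W x = T x * (T x).conjTranspose)
    (hTG : ∀ (x : ℝ) (i j : Fin N),
      HasDerivAt (fun t : ℝ => T t i j) ((evalAt G (x : ℂ) * T x) i j) x) (n : ℕ) (z : ℂ) :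
    compatForm W G z (monicOP W (n + 1 + 1)) (monicOP W (n + 1 + 1)) * gammaCoeff W (n + 1) +
        compatForm W G z (monicOP W (n + 1 + 1)) (monicOP W (n + 1)) *
          (gammaCoeff W (n + 1) * alphaCoeff W (n + 1)) +
        compatForm W G z (monicOP W (n + 1 + 1)) (monicOP W n) * gammaCoeff W n =
      compatForm W G z (monicOP W (n + 1 + 1)) (monicOP W (n + 1)) *
        (gammaCoeff W (n + 1) * Matrix.scalar (Fin N) z) - (n + 1 + 1) := by
  have h := compatForm_X_mul_right hW hWT hTG z (monicOP W (n + 1 + 1)) (monicOP W (n + 1))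
  rw [X_mul_monicOP_succ hW, compatForm_add_right hW, compatForm_add_right hW,
    compatForm_C_mul_right hW, compatForm_C_mul_right hW, mip_derivative_monicOP_succ hW,
    mip_monicOP_derivative hW (Nat.le_succ (n + 1)), mip_one_monicOP_succ hW, mul_zero, sub_zero,
    sub_zero] at h
  have h' := congrArg (· * gammaCoeff W (n + 1)) h
  simp only [add_mul, sub_mul, mul_assoc, mip_mul_gammaCoeff hW, conjTranspose_alphaCoeff_mul hW,
    conjTranspose_betaCoeff_mul hW,
    (Matrix.scalar_commute z (fun _ => Commute.all _ _) (gammaCoeff W (n + 1))).eq] at h'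
  rw [h']
  push_cast
  noncomm_ring

/-- Here the boundary term survives, as `P 0 = 1`: it contributes `P 1 (z) G(z)` with `P 1 (z) = z -
α₀`, accounting for `ℬ₀ = -G`. -/
theorem compatForm_one_right (hW : IsMatrixWeight W)
    (hWT : ∀ x : ℝ, W x = T x * (T x).conjTranspose)
    (hTG : ∀ (x : ℝ) (i j : Fin N),
      HasDerivAt (fun t : ℝ => T t i j) ((evalAt G (x : ℂ) * T x) i j) x) (z : ℂ) :
    compatForm W G z (monicOP W 1) (monicOP W 1) * gammaCoeff W 0 +
        compatForm W G z (monicOP W 1) (monicOP W 0) * (gammaCoeff W 0 * alphaCoeff W 0) =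
      compatForm W G z (monicOP W 1) (monicOP W 0) *
        (gammaCoeff W 0 * Matrix.scalar (Fin N) z) - 1 -
          (Matrix.scalar (Fin N) z - alphaCoeff W 0) * evalAt G z := by
  have h := compatForm_X_mul_right hW hWT hTG z (monicOP W 1) (monicOP W 0)
  have hd := mip_derivative_monicOP_succ hW 0
  rw [Nat.cast_zero, zero_add, zero_add, one_mul] at hd
  have hone : mip W 1 (monicOP W 0) = mip W (monicOP W 0) (monicOP W 0) := by rw [monicOP_zero]
  rw [X_mul_monicOP_zero hW, compatForm_add_right hW, compatForm_C_mul_right hW, hd, hone,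
    mip_monicOP_derivative hW zero_le_one, sub_zero, evalAt_mul, monicOP_one hW, evalAt_sub,
    evalAt_X, evalAt_C, ← monicOP_one hW] at h
  have h' := congrArg (· * gammaCoeff W 0) h
  simp only [add_mul, sub_mul, mul_assoc, mip_mul_gammaCoeff hW, conjTranspose_alphaCoeff_mul hW,
    (Matrix.scalar_commute z (fun _ => Commute.all _ _) (gammaCoeff W 0)).eq] at h'
  rw [h']
  noncomm_ring

theorem first_compatibility (hW : IsMatrixWeight W)
    (hWT : ∀ x : ℝ, W x = T x * (T x).conjTranspose)
    (hTG : ∀ (x : ℝ) (i j : Fin N),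
      HasDerivAt (fun t : ℝ => T t i j) ((evalAt G (x : ℂ) * T x) i j) x) (n : ℕ) (z : ℂ) :
    1 + coeffB W G (n + 1) z * (Matrix.scalar (Fin N) z - alphaCoeff W n) -
        (Matrix.scalar (Fin N) z - alphaCoeff W n) * coeffB W G n z =
      conjStar (coeffA W G (n + 1)) z * betaCoeff W (n + 1) -
        betaCoeff W n * conjStar (coeffA W G (n - 1)) z := by
  have hA : conjStar (coeffA W G (n + 1)) z * betaCoeff W (n + 1) =
      -(compatForm W G z (monicOP W (n + 1)) (monicOP W (n + 1)) * gammaCoeff W n) := by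
    rw [conjStar_coeffA hW, betaCoeff, gammaCoeff_inv hW, neg_mul, mul_assoc,
      ← mul_assoc _ _ (gammaCoeff W n), gammaCoeff_mul_mip hW, one_mul]
  rw [hA, coeffB_succ hW]
  cases n with
  | zero =>
    rw [betaCoeff, zero_mul, sub_zero, coeffB,
      eq_sub_of_add_eq (compatForm_one_right hW hWT hTG z)]
    noncomm_ring
  | succ n =>
    rw [coeffB_succ hW, Nat.add_sub_cancel, conjStar_coeffA hW,
      -- The first substitution introduces `S(P (n+2), P n) γₙ` and the second eliminates it; the
      -- constants `n + 2` and `n + 1` then combine to the identity.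
      eq_sub_of_add_eq (eq_sub_of_add_eq (compatForm_succ_right hW hWT hTG n z)),
      eq_sub_of_add_eq (eq_sub_of_add_eq (compatForm_succ_left hW hWT hTG n z))]
    noncomm_ring

end Compatibility

theorem mainTheorem10 {N : ℕ} (W T : ℝ → Mat N) (G : (Mat N)[X])
    (hpos : ∀ x : ℝ, (W x).PosDef)
    (hmom : ∀ (k : ℕ) (i j : Fin N),
      MeasureTheory.Integrable (fun x : ℝ => (x : ℂ) ^ k * W x i j) MeasureTheory.volume)
    (hWT : ∀ x : ℝ, W x = T x * (T x).conjTranspose)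
    (hTG : ∀ (x : ℝ) (i j : Fin N),
      HasDerivAt (fun t : ℝ => T t i j) ((evalAt G (x : ℂ) * T x) i j) x) :
    -- the monic orthogonal polynomials and their three-term recurrence relation
    IsMonicMOPRL W (monicOP W) ∧
    (X * monicOP W 0 = monicOP W 1 + C (alphaCoeff W 0) * monicOP W 0) ∧
    (∀ n : ℕ, X * monicOP W (n + 1) =
      monicOP W (n + 2) + C (alphaCoeff W (n + 1)) * monicOP W (n + 1) +
        C (betaCoeff W (n + 1)) * monicOP W n) ∧
    -- the compatibility conditions; for `n = 0` the term with `βₙ` is zero, as `β₀ = 0`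
    (∀ (n : ℕ) (z : ℂ),
      1 + coeffB W G (n + 1) z * (Matrix.scalar (Fin N) z - alphaCoeff W n) -
          (Matrix.scalar (Fin N) z - alphaCoeff W n) * coeffB W G n z =
        conjStar (coeffA W G (n + 1)) z * betaCoeff W (n + 1) -
          betaCoeff W n * conjStar (coeffA W G (n - 1)) z) ∧
    (∀ (n : ℕ) (z : ℂ),
      coeffB W G (n + 1) z +
          (gammaCoeff W n)⁻¹ * conjStar (coeffB W G n) z * gammaCoeff W n =
        (Matrix.scalar (Fin N) z - alphaCoeff W n) * conjStar (coeffA W G n) z) := by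
  have hW : IsMatrixWeight W := ⟨hpos, hmom⟩
  exact ⟨isMonicMOPRL_monicOP hW, X_mul_monicOP_zero hW, X_mul_monicOP_succ hW,
    first_compatibility hW hWT hTG, second_compatibility hW hWT hTG⟩
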